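/- A map $M$ on a closed surface $S$ is a finite graph $G$ embedded in $S$ such that (i) the closure of each component of $S\setminus G$ is a $p$-gonal 2-disk for some $p\ge 3$ (a closed disk whose boundary is a cycle of $G$ with $p$ vertices and $p$ edges, and whose interior is the component), called a face of $M$, and (ii) the intersection of any two distinct faces, if non-empty, is a vertex or an edge. A vertex $v$ has face-sequence $(p_1.p_2.\cdots.p_n)$ if the faces at $v$, in their cyclic order around $v$, are a $p_1$-gon, a $p_2$-gon, ..., a $p_n$-gon; face-sequences are considered up to cyclic rotation and reversal, and $p^k$ abbreviates $k$ consecutive entries $p$. The curvature of $v$ is $\phi(v)=1-\frac n2+\sum_{i=1}^n\frac1{p_i}$. The map $M$ is a 2-semi-equivelar map of type $[f_1:f_2]$ if $f_1\neq f_2$ are exactly the face-sequences of the vertices of $M$ (that is, each vertex has face-sequence $f_1$ or $f_2$, and both occur); the order of $f_1,f_2$ is irrelevant. Theorem. Let $M$ be a 2-semi-equivelar map on the torus or the Klein bottle with $\phi(v)=0$ for every vertex $v$. Then the type of $M$ is one of the following 16: $[3^6:3^4.6]$, $[3^6:3^3.4^2]$, $[3^6:3^2.4.3.4]$, $[3^6:3^2.4.12]$,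 $[3^6:3^2.6^2]$, $[3^4.6:3.6.3.6]$, $[3^3.4^2:3^2.4.3.4]$, $[3^3.4^2:3.4.6.4]$, $[3^3.4^2:4^4]$, $[3^2.4.3.4:3.4.6.4]$, $[3^2.6^2:3^4.6]$, $[3^2.6^2:3.6.3.6]$, $[3.4^2.6:3.4.6.4]$, $[3.4^2.6:3.6.3.6]$, $[3.4.6.4:4.6.12]$, $[3.12^2:3.4.3.12]$. -/

import Mathlib

open Set Topology

/-- The torus `S¹ × S¹`. -/
abbrev Torus : Type := Circle × Circle

/-- The side identifications of the unit square that produce the Klein bottle: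
`(0, t) ~ (1, t)` and `(s, 0) ~ (1 - s, 1)`. -/
def kleinRel (a b : unitInterval × unitInterval) : Prop :=
  (a.1 = 0 ∧ b.1 = 1 ∧ a.2 = b.2) ∨ (a.2 = 0 ∧ b.2 = 1 ∧ b.1 = unitInterval.symm a.1)

/-- The Klein bottle, a quotient of the unit square, with the quotient topology. -/
abbrev KleinBottle : Type := Quot kleinRel

/-- A finite graph embedded in a topological space `S`: a finite set `V` of points (the vertices)
and a finite set `E` of arcs in `S` (the edges, each a closed subset of `S` homeomorphic to `[0,1]`)
such that the vertices on an edge are exactly its two ends and two distinct edges meet only in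
vertices. -/
structure EmbeddedGraph (S : Type*) [TopologicalSpace S] where
  V : Set S
  E : Set (Set S)
  finite_V : V.Finite
  finite_E : E.Finite
  isArc : ∀ e ∈ E, ∃ γ : unitInterval → S,
    IsEmbedding γ ∧ range γ = e ∧ γ ⁻¹' V = {0, 1}
  inter_subset : ∀ e ∈ E, ∀ e' ∈ E, e ≠ e' → e ∩ e' ⊆ V

/-- The point `exp (2 π i t / p)` of the unit circle. For `t = 0, 1, …, p - 1` these are the corners
of a `p`-gon whose sides are the circular arcs between consecutive corners. -/
noncomputable def circlePoint (p : ℕ) (t : ℝ) : ℂ :=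
  Complex.exp (2 * Real.pi * t / p * Complex.I)

namespace EmbeddedGraph

variable {S : Type*} [TopologicalSpace S] (G : EmbeddedGraph S)

/-- The union of all vertices and edges, as a subset of `S`. -/
def carrier : Set S := G.V ∪ ⋃₀ G.E

/-- `C` is a connected component of the complement of the graph. -/
def IsRegion (C : Set S) : Prop :=
  ∃ x ∈ G.carrierᶜ, C = connectedComponentIn G.carrierᶜ x

/-- `F` is the closure of a component of the complement of the graph. -/
def IsFace (F : Set S) : Prop :=
  ∃ C, G.IsRegion C ∧ F = closure C

/-- `F` is a face which is a `p`-gonal 2-disk, `p ≥ 3`: it is the closure of a component `C` of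
the complement of the graph, and there is a homeomorphism from the closed unit disk onto `F` that
carries the open disk onto `C`, the `p` corners to vertices and the `p` sides onto edges. -/
def IsGon (p : ℕ) (F : Set S) : Prop :=
  3 ≤ p ∧ ∃ C, G.IsRegion C ∧ F = closure C ∧
    ∃ h : ℂ → S,
      IsEmbedding (fun z : Metric.closedBall (0 : ℂ) 1 => h z) ∧
      h '' Metric.closedBall 0 1 = F ∧
      h '' Metric.ball 0 1 = C ∧
      ∀ k : ℕ, k < p →
        h (circlePoint p k) ∈ G.V ∧ h '' (circlePoint p '' Icc (k : ℝ) (k + 1)) ∈ G.E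

end EmbeddedGraph

/-- A map on `S`: an embedded graph such that the closure of each component of its complement is a
`p`-gonal 2-disk for some `p ≥ 3`, and the intersection of two distinct faces, if it is not empty,
is a vertex or an edge. -/
structure SurfaceMap (S : Type*) [TopologicalSpace S] extends EmbeddedGraph S where
  isGon : ∀ F, toEmbeddedGraph.IsFace F → ∃ p, toEmbeddedGraph.IsGon p F
  inter_faces : ∀ F F', toEmbeddedGraph.IsFace F → toEmbeddedGraph.IsFace F' → F ≠ F' →
    (F ∩ F').Nonempty → (∃ v ∈ V, F ∩ F' = {v}) ∨ F ∩ F' ∈ E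

/-- Two finite sequences describe the same face-sequence if they agree up to a cyclic shift and a
reversal of the direction of rotation. -/
def SameFaceSeq (f g : List ℕ) : Prop := f ~r g ∨ f ~r g.reverse

/-- The curvature `1 - n / 2 + ∑ 1 / pᵢ` of a face-sequence `(p₁, …, pₙ)`. -/
def faceSeqCurvature (f : List ℕ) : ℚ :=
  1 - (f.length : ℚ) / 2 + (f.map fun p => 1 / (p : ℚ)).sum

namespace SurfaceMap

variable {S : Type*} [TopologicalSpace S] (M : SurfaceMap S)

/-- `v` is a vertex with face-sequence `f = (p₀, …, pₙ₋₁)`: the faces at `v` are, without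
repetition, `F₀, …, Fₙ₋₁`, the edges at `v` are, without repetition, `e₀, …, eₙ₋₁`, the face `Fᵢ`
is a `pᵢ`-gon, and `eᵢ` is a common edge of `Fᵢ` and `Fᵢ₊₁` (indices modulo `n`), so that
`F₀, e₀, F₁, e₁, …, Fₙ₋₁, eₙ₋₁` is the cyclic order around `v`. -/
def HasFaceSeq (v : S) (f : List ℕ) : Prop :=
  v ∈ M.V ∧ ∃ F e : Fin f.length → Set S,
    Function.Injective F ∧ Function.Injective e ∧
    range F = {X | M.IsFace X ∧ v ∈ X} ∧
    range e = {a | a ∈ M.E ∧ v ∈ a} ∧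
    ∀ i, M.IsGon (f.get i) (F i) ∧ e i ⊆ F i ∧ e i ⊆ F (finRotate f.length i)

/-- `M` has combinatorial curvature `k` at every vertex. -/
def HasCurvature (k : ℚ) : Prop :=
  ∀ v f, M.HasFaceSeq v f → faceSeqCurvature f = k

/-- `M` is a 2-semi-equivelar map of type `[f₁ : f₂]`: the face-sequences `f₁` and `f₂` are
distinct, both occur in `M`, and every vertex of `M` has one of them. -/
def IsTwoSemiEquivelar (f₁ f₂ : List ℕ) : Prop :=
  ¬ SameFaceSeq f₁ f₂ ∧ (∃ v, M.HasFaceSeq v f₁) ∧ (∃ v, M.HasFaceSeq v f₂) ∧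
    ∀ v ∈ M.V, M.HasFaceSeq v f₁ ∨ M.HasFaceSeq v f₂

end SurfaceMap

/-- The types `[3⁶ : 3⁴.6]`, `[3⁶ : 3³.4²]`, `[3⁶ : 3².4.3.4]`, `[3⁶ : 3².4.12]`, `[3⁶ : 3².6²]`,
`[3⁴.6 : 3.6.3.6]`, `[3³.4² : 3².4.3.4]`, `[3³.4² : 3.4.6.4]`, `[3³.4² : 4⁴]`,
`[3².4.3.4 : 3.4.6.4]`, `[3².6² : 3⁴.6]`, `[3².6² : 3.6.3.6]`, `[3.4².6 : 3.4.6.4]`,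
`[3.4².6 : 3.6.3.6]`, `[3.4.6.4 : 4.6.12]`, `[3.12² : 3.4.3.12]`. -/
def sixteenTypes : List (List ℕ × List ℕ) :=
  [([3, 3, 3, 3, 3, 3], [3, 3, 3, 3, 6]),
   ([3, 3, 3, 3, 3, 3], [3, 3, 3, 4, 4]),
   ([3, 3, 3, 3, 3, 3], [3, 3, 4, 3, 4]),
   ([3, 3, 3, 3, 3, 3], [3, 3, 4, 12]),
   ([3, 3, 3, 3, 3, 3], [3, 3, 6, 6]),
   ([3, 3, 3, 3, 6], [3, 6, 3, 6]),
   ([3, 3, 3, 4, 4], [3, 3, 4, 3, 4]),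
   ([3, 3, 3, 4, 4], [3, 4, 6, 4]),
   ([3, 3, 3, 4, 4], [4, 4, 4, 4]),
   ([3, 3, 4, 3, 4], [3, 4, 6, 4]),
   ([3, 3, 6, 6], [3, 3, 3, 3, 6]),
   ([3, 3, 6, 6], [3, 6, 3, 6]),
   ([3, 4, 4, 6], [3, 4, 6, 4]),
   ([3, 4, 4, 6], [3, 6, 3, 6]),
   ([3, 4, 6, 4], [4, 6, 12]),
   ([3, 12, 12], [3, 4, 3, 12])]

/-! Curvature zero forces the reciprocals of the `n` face sizes to sum to `n / 2 - 1`. As every size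
is at least 3, this gives `3 ≤ n ≤ 6` and bounds the entries, which leaves 21 face-sequences up to
rotation and reversal (`exists_flatType`).

The surface enters only through its connectedness. The faces are closed, finitely many, and cover
it, and two faces that meet share a vertex. If no edge joined a vertex of type `f₁` to one of type
`f₂`, the faces would split the surface into two disjoint nonempty closed sets
(`forall_vertex_of_flipVertex`). So some edge is mixed.

Mixed edges are excluded by local combinatorics. Each flag carries a label, the face sizes read
around its vertex from its face across its edge. Changing the edge or the face of a flag transforms
the label by a fixed rule. Changing the vertex keeps the first two entries, which are the faces on
the two sides of the edge. Going around a `p`-gon returns to the start after `p` steps. Begin with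
all pairs of labels that could stand at the ends of an edge, and repeatedly discard those that
contradict these rules. Pairs realized in the map are never discarded (`mixes_eq_true`), while a
finite computation shows that for two distinct flat types outside the list no mixed pair survives
(`mem_sixteenTypes_of_mixes`).

What remains is to extract this combinatorics from the topological definition: corners and sides of
a face (`IsGon.exists_isPolygon`), the two faces at an edge, and the rotation at a vertex, assembled
in `flagSystem`. -/

/-! ### Face-sequences of curvature zero. -/

namespace SameFaceSeq

theorem refl (f : List ℕ) : SameFaceSeq f f := Or.inl (List.IsRotated.refl f)

theorem symm {f g : List ℕ} (h : SameFaceSeq f g) : SameFaceSeq g f := by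
  rcases h with h | h
  · exact Or.inl h.symm
  · exact Or.inr (by simpa using h.symm.reverse)

theorem trans {f g k : List ℕ} (h : SameFaceSeq f g) (h' : SameFaceSeq g k) :
    SameFaceSeq f k := by
  rcases h with h | h <;> rcases h' with h' | h'
  · exact Or.inl (h.trans h')
  · exact Or.inr (h.trans h')
  · exact Or.inr (h.trans h'.reverse)
  · exact Or.inl (h.trans (by simpa using h'.reverse))

end SameFaceSeq

instance (f g : List ℕ) : Decidable (SameFaceSeq f g) :=
  inferInstanceAs (Decidable (f ~r g ∨ f ~r g.reverse))

/-- Representatives of the face-sequences of curvature zero. -/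
def flatTypes : List (List ℕ) :=
  [[3, 7, 42], [3, 8, 24], [3, 9, 18], [3, 10, 15], [3, 12, 12], [4, 5, 20], [4, 6, 12], [4, 8, 8],
   [5, 5, 10], [6, 6, 6], [3, 3, 4, 12], [3, 4, 3, 12], [3, 3, 6, 6], [3, 6, 3, 6], [3, 4, 4, 6],
   [3, 4, 6, 4], [4, 4, 4, 4], [3, 3, 3, 3, 6], [3, 3, 3, 4, 4], [3, 3, 4, 3, 4],
   [3, 3, 3, 3, 3, 3]]

/-- The hypothesis is `1/a + 1/b + 1/c = 1/2` without denominators. The largest reciprocal is at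
least 1/6, so `a ≤ 6`; then `1/b + 1/c ≥ 1/6` gives `b ≤ 12`, and `c` is determined. -/
theorem flat_triple_sorted {a b c : ℕ} (ha : 3 ≤ a) (hab : a ≤ b) (hbc : b ≤ c)
    (h : 2 * (b * c + a * c + a * b) = a * b * c) : ∃ t ∈ flatTypes, SameFaceSeq [a, b, c] t := by
  have ha' : a ≤ 6 := by
    by_contra hlt
    push Not at hlt
    nlinarith [Nat.mul_le_mul hab hbc, Nat.mul_le_mul_left c hab, Nat.mul_le_mul_left b hbc,
      Nat.mul_le_mul hlt (le_refl (b * c)), Nat.mul_le_mul_right c hab, Nat.mul_le_mul_right b hab,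
      Nat.mul_le_mul_left a hbc, mul_pos (show 0 < b by omega) (show 0 < c by omega)]
  have key : b ≤ 12 := by
    by_contra hlt
    push Not at hlt
    interval_cases a <;> nlinarith
  interval_cases a <;> interval_cases b <;> first
    | omega
    | (obtain rfl : c = 42 := by omega); decide
    | (obtain rfl : c = 24 := by omega); decide
    | (obtain rfl : c = 18 := by omega); decide
    | (obtain rfl : c = 15 := by omega); decide
    | (obtain rfl : c = 12 := by omega); decide
    | (obtain rfl : c = 20 := by omega); decide
    | (obtain rfl : c = 8 := by omega); decide
    | (obtain rfl : c = 10 := by omega); decide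
    | (obtain rfl : c = 6 := by omega); decide

theorem flat_triple {a b c : ℕ} (ha : 3 ≤ a) (hb : 3 ≤ b) (hc : 3 ≤ c)
    (h : 2 * (b * c + a * c + a * b) = a * b * c) : ∃ t ∈ flatTypes, SameFaceSeq [a, b, c] t := by
  have perm : ∀ {x y z : ℕ}, SameFaceSeq [a, b, c] [x, y, z] →
      (∃ t ∈ flatTypes, SameFaceSeq [x, y, z] t) → ∃ t ∈ flatTypes, SameFaceSeq [a, b, c] t :=
    fun hs ⟨t, ht, hst⟩ => ⟨t, ht, hs.trans hst⟩
  rcases le_total a b with hab | hab <;> rcases le_total b c with hbc | hbc <;>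
    rcases le_total a c with hac | hac
  · exact flat_triple_sorted ha hab hbc h
  · exact flat_triple_sorted ha hab hbc h
  · exact perm (Or.inr ⟨1, rfl⟩) (flat_triple_sorted ha hac hbc (by linarith))
  · exact perm (Or.inl ⟨2, rfl⟩) (flat_triple_sorted hc hac hab (by linarith))
  · exact perm (Or.inr ⟨2, rfl⟩) (flat_triple_sorted hb hab hac (by linarith))
  · exact perm (Or.inl ⟨1, rfl⟩) (flat_triple_sorted hb hbc hac (by linarith))
  · exact perm (Or.inr ⟨0, rfl⟩) (flat_triple_sorted hc hbc hab (by linarith))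
  · exact perm (Or.inr ⟨0, rfl⟩) (flat_triple_sorted hc hbc hab (by linarith))

/-- The other three reciprocals sum to less than 1, so not all of `a, b, c` are 3, and the sum is at
most `1/3 + 1/3 + 1/4 = 11/12`. -/
theorem flat_quadruple_le {a b c d : ℕ} (ha : 3 ≤ a) (hb : 3 ≤ b) (hc : 3 ≤ c) (hd : 3 ≤ d)
    (h : (1 / a + 1 / b + 1 / c + 1 / d : ℚ) = 1) : d ≤ 12 := by
  have inv_le : ∀ {m n : ℕ}, 0 < m → m ≤ n → (1 / n : ℚ) ≤ 1 / m := fun hm hmn =>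
    one_div_le_one_div_of_le (by exact_mod_cast hm) (by exact_mod_cast hmn)
  by_contra hlt
  push Not at hlt
  have hd' : (1 / d : ℚ) ≤ 1 / 13 := by exact_mod_cast inv_le (m := 13) (by norm_num) hlt
  have hd0 : (0 : ℚ) < 1 / d := by positivity
  have h3 : ∀ {n : ℕ}, 3 ≤ n → (1 / n : ℚ) ≤ 1 / 3 := fun hn => by
    exact_mod_cast inv_le (m := 3) (by norm_num) hn
  have h4 : ∀ {n : ℕ}, 4 ≤ n → (1 / n : ℚ) ≤ 1 / 4 := fun hn => by
    exact_mod_cast inv_le (m := 4) (by norm_num) hn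
  have h3a := h3 ha
  have h3b := h3 hb
  have h3c := h3 hc
  rcases (by omega : 4 ≤ a ∨ 4 ≤ b ∨ 4 ≤ c ∨ (a = 3 ∧ b = 3 ∧ c = 3)) with h' | h' | h' | h'
  · linarith [h4 h']
  · linarith [h4 h']
  · linarith [h4 h']
  · obtain ⟨rfl, rfl, rfl⟩ := h'
    push_cast at h
    linarith

theorem flat_quadruple_check : ∀ a ∈ List.range' 3 10, ∀ b ∈ List.range' 3 10,
    ∀ c ∈ List.range' 3 10, ∀ d ∈ List.range' 3 10,
    b * c * d + a * c * d + a * b * d + a * b * c = a * b * c * d →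
    ∃ t ∈ flatTypes, SameFaceSeq [a, b, c, d] t := by
  decide +kernel

theorem flat_quintuple_check : ∀ a ∈ List.range' 3 4, ∀ b ∈ List.range' 3 4,
    ∀ c ∈ List.range' 3 4, ∀ d ∈ List.range' 3 4, ∀ e ∈ List.range' 3 4,
    2 * (b * c * d * e + a * c * d * e + a * b * d * e + a * b * c * e + a * b * c * d) =
      3 * (a * b * c * d * e) →
    ∃ t ∈ flatTypes, SameFaceSeq [a, b, c, d, e] t := by
  decide +kernel

/-- In `faceSeqCurvature` the bound variable is elaborated as a rational, so the whole list is
coerced first; here the cast is moved inside the map. -/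
theorem faceSeqCurvature_eq (f : List ℕ) :
    faceSeqCurvature f = 1 - (f.length : ℚ) / 2 + (f.map fun p : ℕ => 1 / (p : ℚ)).sum := by
  have h : (do let a ← f; pure (a : ℚ)) = f.map Nat.cast := by
    simp [List.map_eq_flatMap]
  rw [faceSeqCurvature, h, List.map_map]
  rfl

theorem sum_one_div_le {f : List ℕ} (h3 : ∀ p ∈ f, 3 ≤ p) :
    (f.map fun p : ℕ => 1 / (p : ℚ)).sum ≤ f.length / 3 := by
  induction f with
  | nil => simp
  | cons p f ih =>
    have hp : (1 / p : ℚ) ≤ 1 / 3 :=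
      one_div_le_one_div_of_le (by norm_num) (by exact_mod_cast h3 p (by simp))
    have := ih fun q hq => h3 q (by simp [hq])
    simp only [List.map_cons, List.sum_cons, List.length_cons]
    push_cast
    linarith

theorem sum_one_div_nonneg (f : List ℕ) : 0 ≤ (f.map fun p : ℕ => 1 / (p : ℚ)).sum :=
  List.sum_nonneg (by simp)

theorem flat_length_le {f : List ℕ} (h3 : ∀ p ∈ f, 3 ≤ p) (hf : faceSeqCurvature f = 0) :
    f.length ≤ 6 := by
  have := sum_one_div_le h3
  rw [faceSeqCurvature_eq] at hf
  have h : (f.length : ℚ) ≤ 6 := by linarith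
  exact_mod_cast h

theorem three_le_flat_length {f : List ℕ} (h3 : ∀ p ∈ f, 3 ≤ p) (hf : faceSeqCurvature f = 0) :
    3 ≤ f.length := by
  by_contra hlt
  have hle : (f.length : ℚ) ≤ 2 := by exact_mod_cast (by omega : f.length ≤ 2)
  have h0 := sum_one_div_nonneg f
  rw [faceSeqCurvature_eq] at hf
  match f, h3 with
  | [], _ => simp at hf
  | p :: g, h3 =>
    have hp : (0 : ℚ) < 1 / p := by
      have := h3 p (by simp)
      positivity
    have := sum_one_div_nonneg g
    simp only [List.map_cons, List.sum_cons] at hf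
    linarith

theorem exists_flatType {f : List ℕ} (h3 : ∀ p ∈ f, 3 ≤ p) (hf : faceSeqCurvature f = 0) :
    ∃ t ∈ flatTypes, SameFaceSeq f t := by
  have hle := flat_length_le h3 hf
  have hge := three_le_flat_length h3 hf
  rw [faceSeqCurvature_eq] at hf
  match f with
  | [] | [_] | [_, _] => simp at hge
  | [a, b, c] =>
    simp at h3 hf
    obtain ⟨ha, hb, hc⟩ := h3
    refine flat_triple ha hb hc ?_
    field_simp at hf
    have : (2 * (b * c + a * c + a * b) : ℚ) = a * b * c := by linarith
    exact_mod_cast this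
  | [a, b, c, d] =>
    simp at h3 hf
    obtain ⟨ha, hb, hc, hd⟩ := h3
    have hs : (1 / a + 1 / b + 1 / c + 1 / d : ℚ) = 1 := by simp only [one_div]; linarith
    have mem : ∀ {n : ℕ}, 3 ≤ n → n ≤ 12 → n ∈ List.range' 3 10 := fun h h' => by
      rw [List.mem_range'_1]; omega
    have hd' := flat_quadruple_le ha hb hc hd hs
    have hc' := flat_quadruple_le ha hb hd hc (by linarith)
    have hb' := flat_quadruple_le ha hd hc hb (by linarith)
    have ha' := flat_quadruple_le hd hb hc ha (by linarith)
    refine flat_quadruple_check a (mem ha ha') b (mem hb hb') c (mem hc hc') d (mem hd hd') ?_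
    field_simp at hs
    have : (b * c * d + a * c * d + a * b * d + a * b * c : ℚ) = a * b * c * d := by linarith
    exact_mod_cast this
  | [a, b, c, d, e] =>
    simp at h3 hf
    obtain ⟨ha, hb, hc, hd, he⟩ := h3
    have hs : (1 / a + 1 / b + 1 / c + 1 / d + 1 / e : ℚ) = 3 / 2 := by
      simp only [one_div]; linarith
    have inv3 : ∀ {n : ℕ}, 3 ≤ n → (1 / n : ℚ) ≤ 1 / 3 := fun hn =>
      one_div_le_one_div_of_le (by norm_num) (by exact_mod_cast hn)
    -- Four of the reciprocals sum to at most 4/3, so the fifth is at least `3/2 - 4/3 = 1/6`.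
    have le6 : ∀ {n : ℕ}, 3 ≤ n → (1 / 6 : ℚ) ≤ 1 / n → n ∈ List.range' 3 4 := fun {n} hn hle => by
      have := (one_div_le_one_div (by norm_num) (by positivity)).1 hle
      have : n ≤ 6 := by exact_mod_cast this
      rw [List.mem_range'_1]; omega
    have ha' := inv3 ha
    have hb' := inv3 hb
    have hc' := inv3 hc
    have hd' := inv3 hd
    have he' := inv3 he
    refine flat_quintuple_check a (le6 ha (by linarith)) b (le6 hb (by linarith))
      c (le6 hc (by linarith)) d (le6 hd (by linarith)) e (le6 he (by linarith)) ?_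
    field_simp at hs
    have : (2 * (b * c * d * e + a * c * d * e + a * b * d * e + a * b * c * e + a * b * c * d) : ℚ)
        = 3 * (a * b * c * d * e) := by linarith
    exact_mod_cast this
  | [a, b, c, d, e, g] =>
    simp at h3 hf
    obtain ⟨ha, hb, hc, hd, he, hg⟩ := h3
    have inv3 : ∀ {n : ℕ}, 3 ≤ n → (n : ℚ)⁻¹ ≤ 1 / 3 := fun hn => by
      rw [← one_div]
      exact one_div_le_one_div_of_le (by norm_num) (by exact_mod_cast hn)
    have eq3 : ∀ {n : ℕ}, 3 ≤ n → (1 / 3 : ℚ) ≤ (n : ℚ)⁻¹ → n = 3 := fun {n} hn hle => by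
      rw [← one_div] at hle
      have := (one_div_le_one_div (by norm_num) (by positivity)).1 hle
      have : n ≤ 3 := by exact_mod_cast this
      omega
    have ha' := inv3 ha
    have hb' := inv3 hb
    have hc' := inv3 hc
    have hd' := inv3 hd
    have he' := inv3 he
    have hg' := inv3 hg
    obtain rfl := eq3 ha (by linarith)
    obtain rfl := eq3 hb (by linarith)
    obtain rfl := eq3 hc (by linarith)
    obtain rfl := eq3 hd (by linarith)
    obtain rfl := eq3 he (by linarith)
    obtain rfl := eq3 hg (by linarith)
    decide
  | _ :: _ :: _ :: _ :: _ :: _ :: _ :: _ => simp only [List.length_cons] at hle; omega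

/-! ### Abstract flag systems and the elimination of edge states. -/

/-- Reading a vertex label in the opposite direction, from the same face. -/
def turnBack : List ℕ → List ℕ
  | [] => []
  | p :: t => p :: t.reverse

/-- Reading a vertex label in the opposite direction, from the next face. -/
def crossEdge : List ℕ → List ℕ
  | p :: q :: t => q :: p :: t.reverse
  | l => l

/-- A flag system: three involutions on flags, changing the vertex, the edge and the face, and for
each flag the list of the sizes of the faces around its vertex. -/
structure FlagSystem (Φ : Type*) where
  s0 : Φ → Φ
  s1 : Φ → Φ
  s2 : Φ → Φ
  lab : Φ → List ℕ
  s0_s0 : ∀ x, s0 (s0 x) = x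
  s0_s2 : ∀ x, s0 (s2 x) = s2 (s0 x)
  lab_s1 : ∀ x, lab (s1 x) = turnBack (lab x)
  lab_s2 : ∀ x, lab (s2 x) = crossEdge (lab x)
  take_lab_s0 : ∀ x, (lab (s0 x)).take 2 = (lab x).take 2
  iterate_face : ∀ x p, (lab x).head? = some p → (s1 ∘ s0)^[p] x = x

/-- All lists that describe the face-sequence `t`. -/
def readings (t : List ℕ) : List (List ℕ) :=
  (t.cyclicPermutations ++ t.reverse.cyclicPermutations).dedup

theorem mem_readings {f t : List ℕ} : f ∈ readings t ↔ SameFaceSeq f t := by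
  simp [readings, SameFaceSeq, List.mem_cyclicPermutations_iff]

/-- Pairs of labels that may stand at the two ends of an edge. -/
def edgeStates (X : List (List ℕ)) : List (List ℕ × List ℕ) :=
  X.flatMap fun a => (X.filter fun b => b.take 2 == a.take 2).map fun b => (a, b)

/-- The labels that can be reached from `a` by walking along `n` sides of a face. -/
def sideWalk (E : List (List ℕ × List ℕ)) (a : List ℕ) : ℕ → List (List ℕ)
  | 0 => [a]
  | n + 1 => (sideWalk E a n).flatMap fun c => (E.filter fun e => e.1 == c).map fun e => turnBack e.2

/-- The state `e` has all its neighbours in `E`, and it fits around its face if that is a triangle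
or a square. -/
def fits (E : List (List ℕ × List ℕ)) (e : List ℕ × List ℕ) : Bool :=
  E.contains (e.2, e.1) && E.contains (crossEdge e.1, crossEdge e.2) &&
    (E.any fun d => d.1 == turnBack e.1) &&
    (match e.1 with
      | 3 :: _ => (sideWalk E (turnBack e.2) 2).contains e.1
      | 4 :: _ => (sideWalk E (turnBack e.2) 3).contains e.1
      | _ => true)

/-- Whether a state with ends of types `t₁` and `t₂` survives `n` rounds of elimination. -/
def mixes (t₁ t₂ : List ℕ) : ℕ → List (List ℕ × List ℕ) → Bool
  | 0, E => E.any fun e => (readings t₁).contains e.1 && (readings t₂).contains e.2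
  | n + 1, E => (E.any fun e => (readings t₁).contains e.1 && (readings t₂).contains e.2) &&
      mixes t₁ t₂ n (E.filter (fits E))

namespace FlagSystem

variable {Φ : Type*} (Q : FlagSystem Φ)

/-- The labels at the two ends of the edge of a flag. -/
def state (x : Φ) : List ℕ × List ℕ := (Q.lab x, Q.lab (Q.s0 x))

theorem state_mem_edgeStates {X : List (List ℕ)} (hX : ∀ x, Q.lab x ∈ X) (x : Φ) :
    Q.state x ∈ edgeStates X := by
  simp only [edgeStates, List.mem_flatMap, List.mem_map, List.mem_filter]
  exact ⟨Q.lab x, hX x, Q.lab (Q.s0 x), ⟨hX _, by simp [Q.take_lab_s0]⟩, rfl⟩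

theorem lab_mem_sideWalk {E : List (List ℕ × List ℕ)} (hE : ∀ x, Q.state x ∈ E) (x : Φ) (n : ℕ) :
    Q.lab ((Q.s1 ∘ Q.s0)^[n] x) ∈ sideWalk E (Q.lab x) n := by
  induction n with
  | zero => simp [sideWalk]
  | succ n ih =>
    simp only [sideWalk, List.mem_flatMap, List.mem_map, List.mem_filter]
    refine ⟨_, ih, _, ⟨hE ((Q.s1 ∘ Q.s0)^[n] x), by simp [state]⟩, ?_⟩
    rw [Function.iterate_succ_apply', Function.comp_apply, Q.lab_s1]
    rfl

/-- A full turn around an `(n + 1)`-gon is the identity. Its first step leads to the label `turnBack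
(Q.lab (Q.s0 x))`, so only `n` steps are left to walk. -/
theorem lab_mem_sideWalk_of_head {E : List (List ℕ × List ℕ)} (hE : ∀ x, Q.state x ∈ E) (x : Φ)
    (n : ℕ) (h : (Q.lab x).head? = some (n + 1)) :
    Q.lab x ∈ sideWalk E (turnBack (Q.lab (Q.s0 x))) n := by
  have := Q.lab_mem_sideWalk hE (Q.s1 (Q.s0 x)) n
  rw [Q.lab_s1] at this
  have hx := Q.iterate_face x (n + 1) h
  rw [Function.iterate_succ_apply, Function.comp_apply] at hx
  rwa [hx] at this

theorem fits_state {E : List (List ℕ × List ℕ)} (hE : ∀ x, Q.state x ∈ E) (x : Φ) :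
    fits E (Q.state x) = true := by
  have h0 := hE (Q.s0 x)
  have h1 := hE (Q.s1 x)
  have h2 := hE (Q.s2 x)
  simp only [state, Q.s0_s0, Q.s0_s2, Q.lab_s1, Q.lab_s2] at h0 h1 h2
  simp only [fits, state, Bool.and_eq_true, List.contains_iff_mem, List.any_eq_true]
  refine ⟨⟨⟨h0, h2⟩, _, h1, by simp⟩, ?_⟩
  split
  · next t ht => simpa using Q.lab_mem_sideWalk_of_head hE x 2 (by simp [ht])
  · next t ht => simpa using Q.lab_mem_sideWalk_of_head hE x 3 (by simp [ht])
  · rfl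

/-- Soundness of the elimination: the states of actual flags support one another, so every round
keeps all of them, including the mixed one. -/
theorem mixes_eq_true {E : List (List ℕ × List ℕ)} (hE : ∀ x, Q.state x ∈ E) {t₁ t₂ : List ℕ}
    {x : Φ} (h₁ : SameFaceSeq (Q.lab x) t₁) (h₂ : SameFaceSeq (Q.lab (Q.s0 x)) t₂) (n : ℕ) :
    mixes t₁ t₂ n E = true := by
  have hmix : ∀ E : List (List ℕ × List ℕ), (∀ x, Q.state x ∈ E) →
      (E.any fun e => (readings t₁).contains e.1 && (readings t₂).contains e.2) = true :=
    fun E hE => List.any_eq_true.2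
      ⟨_, hE x, by simp [state, mem_readings, h₁, h₂]⟩
  induction n generalizing E with
  | zero => exact hmix E hE
  | succ n ih =>
    rw [mixes, Bool.and_eq_true]
    exact ⟨hmix E hE, ih fun y => List.mem_filter.2 ⟨hE y, Q.fits_state hE y⟩⟩

end FlagSystem

/-- The finite computation that carries the theorem. Ten rounds are enough for every excluded pair;
by soundness, any number of rounds would be legitimate. -/
theorem mem_sixteenTypes_of_mixes : ∀ t₁ ∈ flatTypes, ∀ t₂ ∈ flatTypes,
    t₁ = t₂ ∨ (t₁, t₂) ∈ sixteenTypes ∨ (t₂, t₁) ∈ sixteenTypes ∨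
      mixes t₁ t₂ 10 (edgeStates (readings t₁ ++ readings t₂)) = false := by
  decide +kernel

/-! ### Corners and sides of a polygonal face. -/

theorem norm_circlePoint (p : ℕ) (t : ℝ) : ‖circlePoint p t‖ = 1 := by
  have : circlePoint p t = Complex.exp ((2 * Real.pi * t / p : ℝ) * Complex.I) := by
    simp [circlePoint]
  rw [this, Complex.norm_exp_ofReal_mul_I]

theorem circlePoint_eq_iff {p : ℕ} (hp : 0 < p) {s t : ℝ} :
    circlePoint p s = circlePoint p t ↔ ∃ n : ℤ, s = t + n * p := by
  have hp' : (p : ℂ) ≠ 0 := by exact_mod_cast hp.ne'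
  have hpi : (Real.pi : ℂ) ≠ 0 := by exact_mod_cast Real.pi_ne_zero
  rw [circlePoint, circlePoint, Complex.exp_eq_exp_iff_exists_int]
  refine exists_congr fun n => ?_
  have : (s = t + n * p) ↔ ((s : ℂ) = t + n * p) := by exact_mod_cast Iff.rfl
  rw [this]
  constructor
  · intro h
    have hI := Complex.I_ne_zero
    field_simp at h
    linear_combination h
  · rintro h
    rw [h]
    field_simp

theorem circlePoint_int_eq_iff {p : ℕ} (hp : 0 < p) {j k : ℤ} :
    circlePoint p j = circlePoint p k ↔ (p : ℤ) ∣ j - k := by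
  rw [circlePoint_eq_iff hp, dvd_iff_exists_eq_mul_left]
  refine exists_congr fun n => ?_
  constructor
  · intro h
    have : j = k + n * p := by exact_mod_cast h
    linarith
  · intro h
    have : j = k + n * p := by linarith
    exact_mod_cast this

theorem circlePoint_image_Icc_congr {p : ℕ} (hp : 0 < p) {j k : ℤ} (h : (p : ℤ) ∣ j - k) :
    circlePoint p '' Icc (j : ℝ) (j + 1) = circlePoint p '' Icc (k : ℝ) (k + 1) := by
  have key : ∀ {j k : ℤ}, (p : ℤ) ∣ j - k →
      circlePoint p '' Icc (j : ℝ) (j + 1) ⊆ circlePoint p '' Icc (k : ℝ) (k + 1) := by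
    rintro j k ⟨n, hn⟩ _ ⟨t, ht, rfl⟩
    have hjk : (j : ℝ) = k + p * n := by
      have : j = k + p * n := by linarith
      exact_mod_cast this
    refine ⟨t - n * p, ⟨by linarith [ht.1], by linarith [ht.2]⟩, ?_⟩
    exact (circlePoint_eq_iff hp).2 ⟨-n, by push_cast; ring⟩
  exact (key h).antisymm (key (by rw [← neg_sub]; exact h.neg_right))

theorem exists_circlePoint_eq {p : ℕ} (hp : 0 < p) {z : ℂ} (hz : ‖z‖ = 1) :
    ∃ t, circlePoint p t = z := by
  refine ⟨z.arg * p / (2 * Real.pi), ?_⟩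
  have hp' : (p : ℂ) ≠ 0 := by exact_mod_cast hp.ne'
  have hpi : (Real.pi : ℂ) ≠ 0 := by exact_mod_cast Real.pi_ne_zero
  conv_rhs => rw [← Complex.norm_mul_exp_arg_mul_I z, hz]
  rw [circlePoint]
  push_cast
  rw [one_mul]
  congr 1
  field_simp

namespace EmbeddedGraph

variable {S : Type*} [TopologicalSpace S] (G : EmbeddedGraph S)

theorem exists_inter_V_eq_pair {e : Set S} (he : e ∈ G.E) : ∃ x y, x ≠ y ∧ e ∩ G.V = {x, y} := by
  obtain ⟨γ, hγ, rfl, hV⟩ := G.isArc e he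
  refine ⟨γ 0, γ 1, fun h => zero_ne_one (hγ.injective h), ?_⟩
  rw [inter_comm, ← image_preimage_eq_inter_range, hV, image_pair]

theorem infinite_edge {e : Set S} (he : e ∈ G.E) : e.Infinite := by
  obtain ⟨γ, hγ, rfl, -⟩ := G.isArc e he
  have : Infinite unitInterval := (Icc_infinite (zero_lt_one' ℝ)).to_subtype
  exact infinite_range_of_injective hγ.injective

/-- The corners `c k` and the sides `a k` of the `p`-gon `F` in cyclic order, indexed modulo `p`,
with all vertices and edges in `F`. -/
structure IsPolygon (p : ℕ) (F : Set S) (c : ℤ → S) (a : ℤ → Set S) : Prop where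
  three_le : 3 ≤ p
  corner_eq_iff : ∀ {j k}, c j = c k ↔ (p : ℤ) ∣ j - k
  side_eq_iff : ∀ {j k}, a j = a k ↔ (p : ℤ) ∣ j - k
  side_mem : ∀ k, a k ∈ G.E
  side_subset : ∀ k, a k ⊆ F
  side_inter : ∀ k, a k ∩ G.V = {c k, c (k + 1)}
  exists_corner : ∀ v ∈ G.V, v ∈ F → ∃ k, v = c k
  exists_side : ∀ e ∈ G.E, e ⊆ F → ∃ k, e = a k

variable {G}

/-- The open disk maps to a region, which avoids the graph, so the graph meets `F` only along the
image of the circle, that is, in the sides. -/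
theorem IsGon.exists_isPolygon {p : ℕ} {F : Set S} (h : G.IsGon p F) :
    ∃ c a, G.IsPolygon p F c a := by
  obtain ⟨hp3, C, ⟨x, -, hC⟩, -, h, hemb, hF, hball, hk⟩ := h
  have hp : 0 < p := by omega
  have hinj : InjOn h (Metric.closedBall 0 1) := injOn_iff_injective.2 hemb.injective
  have hcirc : ∀ t, circlePoint p t ∈ Metric.closedBall (0 : ℂ) 1 := fun t => by
    simp [norm_circlePoint]
  have hCG : ∀ y ∈ C, y ∉ G.carrier := fun y hy => by
    rw [hC] at hy
    exact connectedComponentIn_subset _ _ hy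
  let c : ℤ → S := fun k => h (circlePoint p k)
  let a : ℤ → Set S := fun k => h '' (circlePoint p '' Icc (k : ℝ) (k + 1))
  have hmod : ∀ k : ℤ, ∃ m : ℕ, m < p ∧ (p : ℤ) ∣ k - (m : ℤ) := fun k => by
    have hp' : (p : ℤ) ≠ 0 := by omega
    have hm := Int.emod_nonneg k hp'
    refine ⟨(k % p).toNat, ?_, ?_⟩
    · have := Int.emod_lt_of_pos k (by omega : (0 : ℤ) < p)
      omega
    · rw [Int.toNat_of_nonneg hm]
      exact Int.dvd_self_sub_emod
  have hcc : ∀ {j k}, c j = c k ↔ (p : ℤ) ∣ j - k := fun {j k} => by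
    rw [← circlePoint_int_eq_iff hp]
    exact hinj.eq_iff (hcirc _) (hcirc _)
  have haper : ∀ {j k}, (p : ℤ) ∣ j - k → a j = a k := fun hjk => by
    simp only [a, circlePoint_image_Icc_congr hp hjk]
  have hcV : ∀ k, c k ∈ G.V := fun k => by
    obtain ⟨m, hm, hd⟩ := hmod k
    rw [hcc.2 hd]
    simpa [c] using (hk m hm).1
  have haE : ∀ k, a k ∈ G.E := fun k => by
    obtain ⟨m, hm, hd⟩ := hmod k
    rw [haper hd]
    simpa [a] using (hk m hm).2
  have haF : ∀ k, a k ⊆ F := fun k => by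
    rw [← hF]
    refine image_mono ?_
    rintro _ ⟨t, -, rfl⟩
    exact hcirc t
  have hav : ∀ k, a k ∩ G.V = {c k, c (k + 1)} := fun k => by
    obtain ⟨u, w, huw, he⟩ := G.exists_inter_V_eq_pair (haE k)
    have h0 : c k ∈ a k ∩ G.V :=
      ⟨mem_image_of_mem _ (mem_image_of_mem _ ⟨le_rfl, by linarith⟩), hcV k⟩
    have h1 : c (k + 1) ∈ a k ∩ G.V :=
      ⟨mem_image_of_mem _ ⟨(k : ℝ) + 1, ⟨by linarith, le_rfl⟩, by simp⟩, hcV _⟩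
    have hne : c k ≠ c (k + 1) := by
      rw [Ne, hcc]
      rintro ⟨n, hn⟩
      have h1 : (p : ℤ) ∣ 1 := ⟨-n, by linarith⟩
      have := Int.le_of_dvd one_pos h1
      omega
    rw [he] at h0 h1 ⊢
    simp only [mem_insert_iff, mem_singleton_iff] at h0 h1
    rcases h0 with h0 | h0 <;> rcases h1 with h1 | h1
    · exact absurd (h0.trans h1.symm) hne
    · rw [h0, h1]
    · rw [h0, h1, pair_comm]
    · exact absurd (h0.trans h1.symm) hne
  have hbd : ∀ y ∈ F, y ∈ G.carrier → ∃ k, y ∈ a k := fun y hy hyG => by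
    rw [← hF] at hy
    obtain ⟨z, hz, rfl⟩ := hy
    have hz1 : ‖z‖ = 1 := by
      refine le_antisymm (by simpa using hz) (not_lt.1 fun hlt => ?_)
      refine hCG (h z) ?_ hyG
      rw [← hball]
      exact mem_image_of_mem _ (by simpa using hlt)
    obtain ⟨t, rfl⟩ := exists_circlePoint_eq hp hz1
    exact ⟨⌊t⌋, mem_image_of_mem _
      (mem_image_of_mem _ ⟨Int.floor_le t, (Int.lt_floor_add_one t).le⟩)⟩
  refine ⟨c, a, hp3, hcc, fun {j k} => ⟨fun hjk => ?_, haper⟩, haE, haF, hav,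
    fun v hv hvF => ?_, fun e he heF => ?_⟩
  -- Sides with the same ends have congruent indices; the crossed matching of the ends would give `p
  -- ∣ 2`, against `p ≥ 3`.
  · have hpair : ({c j, c (j + 1)} : Set S) = {c k, c (k + 1)} := by rw [← hav, ← hav, hjk]
    have hj : c j ∈ ({c k, c (k + 1)} : Set S) := hpair ▸ mem_insert _ _
    have hk' : c k ∈ ({c j, c (j + 1)} : Set S) := hpair ▸ mem_insert _ _
    simp only [mem_insert_iff, mem_singleton_iff, hcc] at hj hk'
    rcases hj with hj | hj
    · exact hj
    rcases hk' with hk' | hk'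
    · rw [← neg_sub]
      exact hk'.neg_right
    · have h2 : (p : ℤ) ∣ 2 := by
        have := (hj.add hk').neg_right
        ring_nf at this
        exact this
      have := Int.le_of_dvd two_pos h2
      omega
  · obtain ⟨k, hk'⟩ := hbd v hvF (Or.inl hv)
    have : v ∈ ({c k, c (k + 1)} : Set S) := hav k ▸ ⟨hk', hv⟩
    rcases this with h' | h'
    · exact ⟨k, h'⟩
    · exact ⟨k + 1, h'⟩
  -- An edge inside `F` other than the sides would meet them only in vertices, hence be finite.
  · by_contra! hne
    refine G.infinite_edge he (G.finite_V.subset fun y hy => ?_)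
    obtain ⟨k, hk'⟩ := hbd y (heF hy) (Or.inr ⟨e, he, hy⟩)
    exact G.inter_subset e he (a k) (haE k) (hne k) ⟨hy, hk'⟩

namespace IsPolygon

variable {p : ℕ} {F : Set S} {c : ℤ → S} {a : ℤ → Set S}

theorem not_dvd_one (h : G.IsPolygon p F c a) : ¬(p : ℤ) ∣ 1 := fun h1 => by
  have := Int.le_of_dvd one_pos h1
  have := h.three_le
  omega

theorem corner_mem_side (h : G.IsPolygon p F c a) (k : ℤ) : c k ∈ a k ∩ G.V := by
  rw [h.side_inter]
  simp

theorem corner_succ_mem_side (h : G.IsPolygon p F c a) (k : ℤ) : c (k + 1) ∈ a k ∩ G.V := by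
  rw [h.side_inter]
  simp

/-- This makes `p` an invariant of the set `F`, independent of the chosen parametrization. -/
theorem ncard_inter_V (h : G.IsPolygon p F c a) : (F ∩ G.V).ncard = p := by
  have hp : 0 < p := by have := h.three_le; omega
  have heq : F ∩ G.V = c '' (Finset.Ico (0 : ℤ) p : Finset ℤ) := by
    ext v
    constructor
    · rintro ⟨hF, hV⟩
      obtain ⟨k, rfl⟩ := h.exists_corner v hV hF
      refine ⟨k % p, ?_, ?_⟩
      · have h1 := Int.emod_nonneg k (by omega : (p : ℤ) ≠ 0)
        have h2 := Int.emod_lt_of_pos k (by omega : (0 : ℤ) < p)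
        simp [h1, h2]
      · rw [h.corner_eq_iff, ← neg_sub]
        exact Int.dvd_self_sub_emod.neg_right
    · rintro ⟨k, -, rfl⟩
      exact ⟨h.side_subset k (h.corner_mem_side k).1, (h.corner_mem_side k).2⟩
  rw [heq, InjOn.ncard_image, ncard_coe_finset]
  · simp
  · intro i hi j hj hij
    simp only [Finset.coe_Ico, mem_Ico] at hi hj
    obtain ⟨n, hn⟩ := h.corner_eq_iff.1 hij
    have h1 : (p : ℤ) * n < p * 1 := by linarith
    have h2 : (p : ℤ) * (-1) < p * n := by linarith
    have hn1 := lt_of_mul_lt_mul_left h1 (by omega)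
    have hn2 := lt_of_mul_lt_mul_left h2 (by omega)
    obtain rfl : n = 0 := by omega
    linarith

theorem corner_mem_side_iff (h : G.IsPolygon p F c a) {j k : ℤ} :
    c k ∈ a j ↔ a j = a k ∨ a j = a (k - 1) := by
  constructor
  · intro hk
    have : c k ∈ a j ∩ G.V := ⟨hk, (h.corner_mem_side k).2⟩
    rw [h.side_inter] at this
    simp only [mem_insert_iff, mem_singleton_iff, h.corner_eq_iff] at this
    rw [h.side_eq_iff, h.side_eq_iff]
    rcases this with h' | h'
    · left
      rw [← neg_sub]
      exact h'.neg_right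
    · right
      rw [← neg_sub, show k - 1 - j = k - (j + 1) by ring]
      exact h'.neg_right
  · rintro (h' | h') <;> rw [h']
    · exact (h.corner_mem_side k).1
    · simpa using (h.corner_succ_mem_side (k - 1)).1

theorem side_ne_side_pred (h : G.IsPolygon p F c a) (k : ℤ) : a k ≠ a (k - 1) := by
  rw [Ne, h.side_eq_iff, sub_sub_cancel]
  exact h.not_dvd_one

theorem corner_ne_corner_succ (h : G.IsPolygon p F c a) (k : ℤ) : c (k + 1) ≠ c k := by
  rw [Ne, h.corner_eq_iff, add_sub_cancel_left]
  exact h.not_dvd_one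

end IsPolygon

end EmbeddedGraph

/-! ### Pairs of alternatives, and reversal of periodic lists. -/

/-- Exactly two objects satisfy `P`. -/
def ExactlyTwo {α : Type*} (P : α → Prop) : Prop := ∃ a b, a ≠ b ∧ ∀ x, P x ↔ x = a ∨ x = b

namespace ExactlyTwo

variable {α : Type*} {P : α → Prop}

theorem exists_ne (h : ExactlyTwo P) (x : α) : ∃ y, P y ∧ y ≠ x := by
  obtain ⟨a, b, hab, hP⟩ := h
  by_cases hx : a = x
  · exact ⟨b, (hP b).2 (Or.inr rfl), fun hb => hab (hx.trans hb.symm)⟩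
  · exact ⟨a, (hP a).2 (Or.inl rfl), hx⟩

theorem eq_of_ne (h : ExactlyTwo P) {x y z : α} (hx : P x) (hy : P y) (hz : P z) (hxz : x ≠ z)
    (hyz : y ≠ z) : x = y := by
  obtain ⟨a, b, -, hP⟩ := h
  rw [hP] at hx hy hz
  rcases hx with rfl | rfl <;> rcases hy with rfl | rfl <;> rcases hz with rfl | rfl <;>
    first | rfl | exact absurd rfl hxz | exact absurd rfl hyz

end ExactlyTwo

theorem turnBack_map_range {g : ℕ → ℕ} {n : ℕ} (hn : 2 ≤ n) (h0 : g n = g 0) :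
    turnBack ((List.range n).map g) = (List.range n).map fun k => g (n - k) := by
  obtain ⟨m, rfl⟩ := Nat.exists_eq_add_of_le' hn
  rw [List.range_succ_eq_map, List.map_cons, List.map_cons, turnBack, Nat.sub_zero, h0]
  congr 1
  refine List.ext_getElem (by simp) fun i h₁ h₂ => ?_
  simp only [List.length_map, List.length_range] at h₂
  simp only [List.getElem_reverse, List.getElem_map, List.getElem_range, List.length_map,
    List.length_range]
  congr 1
  omega

theorem crossEdge_map_range {g : ℕ → ℕ} {n : ℕ} (hn : 2 ≤ n) (h0 : g n = g 0)
    (h1 : g (n + 1) = g 1) :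
    crossEdge ((List.range n).map g) = (List.range n).map fun k => g (n - k + 1) := by
  obtain ⟨m, rfl⟩ := Nat.exists_eq_add_of_le' hn
  rw [List.range_succ_eq_map, List.range_succ_eq_map]
  simp only [List.map_cons, List.map_map, crossEdge, Nat.sub_zero]
  congr 1
  · exact h1.symm
  congr 1
  · exact h0.symm
  refine List.ext_getElem (by simp) fun i h₁ h₂ => ?_
  simp only [List.length_map, List.length_range] at h₂
  simp only [List.getElem_reverse, List.getElem_map, List.getElem_range, List.length_map,
    List.length_range, Function.comp_apply]
  congr 1
  omega

theorem sameFaceSeq_turnBack (L : List ℕ) : SameFaceSeq (turnBack L) L := by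
  cases L with
  | nil => exact SameFaceSeq.refl _
  | cons p t =>
    refine Or.inr ?_
    rw [turnBack, List.reverse_cons]
    exact ⟨1, by simp⟩

theorem coe_finRotate_eq_mod {n : ℕ} (i : Fin n) : (finRotate n i : ℕ) = (i + 1) % n := by
  cases n with
  | zero => exact i.elim0
  | succ m => rw [finRotate_apply, Fin.val_add, Fin.val_one', Nat.add_mod_mod]

/-! ### The cyclic order of faces and edges at a vertex. -/

namespace SurfaceMap

variable {S : Type*} [TopologicalSpace S] (M : SurfaceMap S)

/-- Every vertex has a face-sequence with at least three entries. -/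
def IsLocallyCyclic : Prop := ∀ v ∈ M.V, ∃ f, 3 ≤ f.length ∧ M.HasFaceSeq v f

/-- The number of vertices on a face. -/
noncomputable def faceSize (F : Set S) : ℕ := (F ∩ M.V).ncard

/-- The number of edges at a vertex. -/
noncomputable def degree (v : S) : ℕ := {a | a ∈ M.E ∧ v ∈ a}.ncard

variable {M}

theorem faceSize_eq {p : ℕ} {F : Set S} (h : M.IsGon p F) : M.faceSize F = p := by
  obtain ⟨c, a, h⟩ := h.exists_isPolygon
  exact h.ncard_inter_V

theorem exists_isPolygon {F : Set S} (hF : M.IsFace F) :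
    ∃ c a, M.IsPolygon (M.faceSize F) F c a := by
  obtain ⟨p, hp⟩ := M.isGon F hF
  rw [faceSize_eq hp]
  exact hp.exists_isPolygon

theorem exactlyTwo_vertices {e : Set S} (he : e ∈ M.E) :
    ExactlyTwo fun v => v ∈ M.V ∧ v ∈ e := by
  obtain ⟨x, y, hxy, h⟩ := M.exists_inter_V_eq_pair he
  refine ⟨x, y, hxy, fun v => ?_⟩
  have hv : v ∈ e ∩ M.V ↔ v = x ∨ v = y := by simp [h]
  exact and_comm.trans hv

theorem exactlyTwo_edges {F : Set S} (hF : M.IsFace F) {v : S} (hv : v ∈ M.V) (hvF : v ∈ F) :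
    ExactlyTwo fun e => e ∈ M.E ∧ v ∈ e ∧ e ⊆ F := by
  obtain ⟨c, a, h⟩ := exists_isPolygon hF
  obtain ⟨k, rfl⟩ := h.exists_corner v hv hvF
  refine ⟨a k, a (k - 1), h.side_ne_side_pred k, fun e => ⟨?_, ?_⟩⟩
  · rintro ⟨he, hve, heF⟩
    obtain ⟨j, rfl⟩ := h.exists_side e he heF
    exact h.corner_mem_side_iff.1 hve
  · rintro (rfl | rfl)
    · exact ⟨h.side_mem _, h.corner_mem_side_iff.2 (Or.inl rfl), h.side_subset _⟩
    · exact ⟨h.side_mem _, h.corner_mem_side_iff.2 (Or.inr rfl), h.side_subset _⟩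

/-- The faces `F i` and the edges `e i` at `v` in their cyclic order, indexed modulo the length of
the face-sequence `f`. -/
structure IsRotation (M : SurfaceMap S) (v : S) (f : List ℕ) (F e : ℕ → Set S) : Prop where
  mem_V : v ∈ M.V
  face_eq_iff : ∀ {i j}, F i = F j ↔ i ≡ j [MOD f.length]
  edge_eq_iff : ∀ {i j}, e i = e j ↔ i ≡ j [MOD f.length]
  isFace_iff : ∀ {X}, M.IsFace X ∧ v ∈ X ↔ ∃ i, X = F i
  isEdge_iff : ∀ {a}, a ∈ M.E ∧ v ∈ a ↔ ∃ i, a = e i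
  isGon : ∀ i (h : i % f.length < f.length), M.IsGon f[i % f.length] (F i)
  edge_subset : ∀ i, e i ⊆ F i
  edge_subset_succ : ∀ i, e i ⊆ F (i + 1)

theorem HasFaceSeq.exists_isRotation {v : S} {f : List ℕ} (h : M.HasFaceSeq v f)
    (hf : f ≠ []) : ∃ F e, M.IsRotation v f F e := by
  obtain ⟨hv, F, e, hF, he, hFr, her, hinc⟩ := h
  have hn : 0 < f.length := List.length_pos_iff.2 hf
  let r : ℕ → Fin f.length := fun i => ⟨i % f.length, Nat.mod_lt _ hn⟩
  have hr : ∀ {i j}, r i = r j ↔ i ≡ j [MOD f.length] := by simp [r, Nat.ModEq]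
  have hr' : ∀ i : Fin f.length, r i = i := fun i => Fin.ext (Nat.mod_eq_of_lt i.2)
  have hrs : ∀ i, r (i + 1) = finRotate f.length (r i) := fun i => by
    apply Fin.ext
    rw [coe_finRotate_eq_mod]
    simp [r]
  refine ⟨fun i => F (r i), fun i => e (r i), hv, fun {i j} => hF.eq_iff.trans hr,
    fun {i j} => he.eq_iff.trans hr, fun {X} => ?_, fun {a} => ?_, fun i _ => (hinc (r i)).1,
    fun i => (hinc (r i)).2.1, fun i => ?_⟩
  · change X ∈ {X | M.IsFace X ∧ v ∈ X} ↔ _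
    rw [← hFr]
    exact ⟨fun ⟨i, hi⟩ => ⟨i, by rw [hr', hi]⟩, fun ⟨i, hi⟩ => ⟨r i, hi.symm⟩⟩
  · change a ∈ {a | a ∈ M.E ∧ v ∈ a} ↔ _
    rw [← her]
    exact ⟨fun ⟨i, hi⟩ => ⟨i, by rw [hr', hi]⟩, fun ⟨i, hi⟩ => ⟨r i, hi.symm⟩⟩
  · simp only [hrs]
    exact (hinc (r i)).2.2

namespace IsRotation

variable {v : S} {f : List ℕ} {F e : ℕ → Set S}

theorem degree_eq (h : M.IsRotation v f F e) (hf : 0 < f.length) : M.degree v = f.length := by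
  have heq : {a | a ∈ M.E ∧ v ∈ a} = e '' (Finset.range f.length : Finset ℕ) := by
    ext a
    refine h.isEdge_iff.trans ⟨?_, ?_⟩
    · rintro ⟨i, rfl⟩
      exact ⟨i % f.length, by simpa using Nat.mod_lt _ hf, h.edge_eq_iff.2 (Nat.mod_modEq _ _)⟩
    · rintro ⟨i, -, rfl⟩
      exact ⟨i, rfl⟩
  rw [degree, heq, InjOn.ncard_image, ncard_coe_finset, Finset.card_range]
  intro i hi j hj hij
  simp only [Finset.coe_range, mem_Iio] at hi hj
  exact (h.edge_eq_iff.1 hij).eq_of_lt_of_lt hi hj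

theorem not_modEq_succ (hf : 2 ≤ f.length) (i : ℕ) : ¬i + 1 ≡ i [MOD f.length] := fun h => by
  have h' : f.length ∣ 1 := by
    simpa using (Nat.modEq_iff_dvd' (Nat.le_succ i)).1 h.symm
  have := Nat.le_of_dvd one_pos h'
  omega

/-- A face containing `e i` contains `v`, so it is some `F (m + 1)`. Its only two edges at `v` are
`e m` and `e (m + 1)`, so `i` is congruent to `m` or `m + 1`. -/
theorem exactlyTwo_faces (h : M.IsRotation v f F e) (hf : 2 ≤ f.length) (i : ℕ) :
    ExactlyTwo fun X => M.IsFace X ∧ e i ⊆ X := by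
  have hface : ∀ j, M.IsFace (F j) ∧ v ∈ F j := fun j => h.isFace_iff.2 ⟨j, rfl⟩
  have hedge : ∀ j, e j ∈ M.E ∧ v ∈ e j := fun j => h.isEdge_iff.2 ⟨j, rfl⟩
  refine ⟨F (i + 1), F i, fun hi => not_modEq_succ hf i (h.face_eq_iff.1 hi), fun X => ⟨?_, ?_⟩⟩
  · rintro ⟨hX, hiX⟩
    obtain ⟨j, rfl⟩ := h.isFace_iff.1 ⟨hX, hiX (hedge i).2⟩
    obtain ⟨m, hm⟩ : ∃ m, m + 1 ≡ j [MOD f.length] :=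
      ⟨j + (f.length - 1), by
        rw [show j + (f.length - 1) + 1 = j + f.length by omega]
        exact Nat.add_modEq_right⟩
    rw [← h.face_eq_iff.2 hm] at hiX ⊢
    by_cases him : e i = e m
    · exact Or.inl (h.face_eq_iff.2 ((h.edge_eq_iff.1 him).add_right 1).symm)
    · have := (exactlyTwo_edges (hface (m + 1)).1 h.mem_V (hface (m + 1)).2).eq_of_ne
        (x := e i) (y := e (m + 1)) (z := e m)
        ⟨(hedge _).1, (hedge _).2, hiX⟩ ⟨(hedge _).1, (hedge _).2, h.edge_subset _⟩
        ⟨(hedge _).1, (hedge _).2, h.edge_subset_succ _⟩ him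
        fun hm' => not_modEq_succ hf m (h.edge_eq_iff.1 hm')
      exact Or.inr (h.face_eq_iff.2 (h.edge_eq_iff.1 this).symm)
  · rintro (rfl | rfl)
    · exact ⟨(hface _).1, h.edge_subset_succ _⟩
    · exact ⟨(hface _).1, h.edge_subset _⟩

end IsRotation

theorem IsLocallyCyclic.exactlyTwo_faces (hM : M.IsLocallyCyclic) {e : Set S} (he : e ∈ M.E) :
    ExactlyTwo fun X => M.IsFace X ∧ e ⊆ X := by
  obtain ⟨v, w, -, hv⟩ := exactlyTwo_vertices he
  obtain ⟨hvV, hve⟩ := (hv v).2 (Or.inl rfl)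
  obtain ⟨f, hf, hvf⟩ := hM v hvV
  obtain ⟨F, e', h⟩ := hvf.exists_isRotation (List.length_pos_iff.1 (by omega))
  obtain ⟨i, rfl⟩ := h.isEdge_iff.1 ⟨he, hve⟩
  exact h.exactlyTwo_faces (by omega) i

/-! ### Flags and their three flips. -/

/-- A vertex, an edge and a face that are pairwise incident. -/
@[ext]
structure Flag (M : SurfaceMap S) where
  vertex : S
  edge : Set S
  face : Set S
  vertex_mem : vertex ∈ M.V
  edge_mem : edge ∈ M.E
  isFace : M.IsFace face
  vertex_mem_edge : vertex ∈ edge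
  edge_subset_face : edge ⊆ face

namespace Flag

theorem vertex_mem_face (x : Flag M) : x.vertex ∈ x.face := x.edge_subset_face x.vertex_mem_edge

/-- The flag with the other vertex. -/
noncomputable def flipVertex (x : Flag M) : Flag M :=
  have h := ((exactlyTwo_vertices x.edge_mem).exists_ne x.vertex).choose_spec
  ⟨_, x.edge, x.face, h.1.1, x.edge_mem, x.isFace, h.1.2, x.edge_subset_face⟩

/-- The flag with the other edge. -/
noncomputable def flipEdge (x : Flag M) : Flag M :=
  have h := ((exactlyTwo_edges x.isFace x.vertex_mem x.vertex_mem_face).exists_ne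
    x.edge).choose_spec
  ⟨x.vertex, _, x.face, x.vertex_mem, h.1.1, x.isFace, h.1.2.1, h.1.2.2⟩

/-- The flag with the other face. -/
noncomputable def flipFace (hM : M.IsLocallyCyclic) (x : Flag M) : Flag M :=
  have h := ((hM.exactlyTwo_faces x.edge_mem).exists_ne x.face).choose_spec
  ⟨x.vertex, x.edge, _, x.vertex_mem, x.edge_mem, h.1.1, x.vertex_mem_edge, h.1.2⟩

@[simp] theorem edge_flipVertex (x : Flag M) : x.flipVertex.edge = x.edge := rfl
@[simp] theorem face_flipVertex (x : Flag M) : x.flipVertex.face = x.face := rfl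
@[simp] theorem face_flipEdge (x : Flag M) : x.flipEdge.face = x.face := rfl

theorem vertex_flipVertex_ne (x : Flag M) : x.flipVertex.vertex ≠ x.vertex :=
  ((exactlyTwo_vertices x.edge_mem).exists_ne x.vertex).choose_spec.2

theorem edge_flipEdge_ne (x : Flag M) : x.flipEdge.edge ≠ x.edge :=
  ((exactlyTwo_edges x.isFace x.vertex_mem x.vertex_mem_face).exists_ne x.edge).choose_spec.2

theorem vertex_flipVertex_eq (x : Flag M) {w : S} (hw : w ∈ M.V) (hwe : w ∈ x.edge)
    (hne : w ≠ x.vertex) : x.flipVertex.vertex = w :=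
  (exactlyTwo_vertices x.edge_mem).eq_of_ne
    ⟨x.flipVertex.vertex_mem, x.flipVertex.vertex_mem_edge⟩ ⟨hw, hwe⟩
    ⟨x.vertex_mem, x.vertex_mem_edge⟩ x.vertex_flipVertex_ne hne

theorem edge_flipEdge_eq (x : Flag M) {e : Set S} (he : e ∈ M.E) (hve : x.vertex ∈ e)
    (heF : e ⊆ x.face) (hne : e ≠ x.edge) : x.flipEdge.edge = e :=
  (exactlyTwo_edges x.isFace x.vertex_mem x.vertex_mem_face).eq_of_ne
    ⟨x.flipEdge.edge_mem, x.flipEdge.vertex_mem_edge, x.flipEdge.edge_subset_face⟩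
    ⟨he, hve, heF⟩ ⟨x.edge_mem, x.vertex_mem_edge, x.edge_subset_face⟩ x.edge_flipEdge_ne hne

theorem flipVertex_flipVertex (x : Flag M) : x.flipVertex.flipVertex = x :=
  Flag.ext (x.flipVertex.vertex_flipVertex_eq x.vertex_mem x.vertex_mem_edge
    x.vertex_flipVertex_ne.symm) rfl rfl

theorem flipEdge_flipEdge (x : Flag M) : x.flipEdge.flipEdge = x :=
  Flag.ext rfl (x.flipEdge.edge_flipEdge_eq x.edge_mem x.vertex_mem_edge x.edge_subset_face
    x.edge_flipEdge_ne.symm) rfl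

theorem iterate_flipEdge_flipVertex (x : Flag M) :
    (flipEdge ∘ flipVertex)^[M.faceSize x.face] x = x := by
  obtain ⟨c, a, h⟩ := exists_isPolygon x.isFace
  have hface : ∀ j, ((flipEdge ∘ flipVertex)^[j] x).face = x.face := fun j => by
    induction j with
    | zero => rfl
    | succ j ih => rw [Function.iterate_succ_apply', ← ih]; rfl
  have hper : ∀ k : ℤ, c (k + M.faceSize x.face) = c k ∧ a (k + M.faceSize x.face) = a k ∧
      c (k - M.faceSize x.face) = c k ∧ a (k - M.faceSize x.face) = a k := fun k => by
    simp [h.corner_eq_iff, h.side_eq_iff]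
  obtain ⟨k, hk⟩ := h.exists_side x.edge x.edge_mem x.edge_subset_face
  have hv : x.vertex ∈ a k ∩ M.V := ⟨hk ▸ x.vertex_mem_edge, x.vertex_mem⟩
  rw [h.side_inter] at hv
  -- The vertex is one of the two ends of the side `a k`, and this decides whether the walk runs
  -- with increasing or decreasing indices.
  rcases hv with hv | hv
  · have hit : ∀ j : ℕ, ((flipEdge ∘ flipVertex)^[j] x).vertex = c (k + j) ∧
        ((flipEdge ∘ flipVertex)^[j] x).edge = a (k + j) := fun j => by
      induction j with
      | zero => simpa using ⟨hv, hk⟩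
      | succ j ih =>
        rw [Function.iterate_succ_apply', Function.comp_apply, Nat.cast_succ, ← add_assoc]
        have hf := hface j
        set y := (flipEdge ∘ flipVertex)^[j] x
        obtain ⟨hyv, hye⟩ := ih
        have h1 : y.flipVertex.vertex = c (k + j + 1) := by
          have := h.corner_succ_mem_side (k + j)
          refine y.vertex_flipVertex_eq this.2 (hye ▸ this.1) ?_
          rw [hyv]
          exact h.corner_ne_corner_succ _
        refine ⟨h1, y.flipVertex.edge_flipEdge_eq (h.side_mem _) ?_ ?_ ?_⟩
        · rw [h1]
          exact (h.corner_mem_side _).1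
        · rw [face_flipVertex, hf]
          exact h.side_subset _
        · rw [edge_flipVertex, hye]
          simpa using h.side_ne_side_pred (k + j + 1)
    obtain ⟨h1, h2⟩ := hit (M.faceSize x.face)
    refine Flag.ext (h1.trans ?_) (h2.trans ?_) (hface _)
    · rw [(hper k).1, hv]
    · rw [(hper k).2.1, hk]
  · have hit : ∀ j : ℕ, ((flipEdge ∘ flipVertex)^[j] x).vertex = c (k - j + 1) ∧
        ((flipEdge ∘ flipVertex)^[j] x).edge = a (k - j) := fun j => by
      induction j with
      | zero => simpa using ⟨hv, hk⟩
      | succ j ih =>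
        rw [Function.iterate_succ_apply', Function.comp_apply, Nat.cast_succ, ← sub_sub,
          sub_add_cancel]
        have hf := hface j
        set y := (flipEdge ∘ flipVertex)^[j] x
        obtain ⟨hyv, hye⟩ := ih
        have h1 : y.flipVertex.vertex = c (k - j) := by
          have := h.corner_mem_side (k - j)
          refine y.vertex_flipVertex_eq this.2 (hye ▸ this.1) ?_
          rw [hyv]
          exact (h.corner_ne_corner_succ _).symm
        refine ⟨h1, y.flipVertex.edge_flipEdge_eq (h.side_mem _) ?_ ?_ ?_⟩
        · rw [h1]
          exact h.corner_mem_side_iff.2 (Or.inr rfl)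
        · rw [face_flipVertex, hf]
          exact h.side_subset _
        · rw [edge_flipVertex, hye]
          exact (h.side_ne_side_pred _).symm
    obtain ⟨h1, h2⟩ := hit (M.faceSize x.face)
    refine Flag.ext (h1.trans ?_) (h2.trans ?_) (hface _)
    · rw [sub_add_eq_add_sub, (hper (k + 1)).2.2.1, hv]
    · rw [(hper k).2.2.2, hk]

variable (hM : M.IsLocallyCyclic)

@[simp] theorem vertex_flipFace (x : Flag M) : (x.flipFace hM).vertex = x.vertex := rfl
@[simp] theorem edge_flipFace (x : Flag M) : (x.flipFace hM).edge = x.edge := rfl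

theorem face_flipFace_ne (x : Flag M) : (x.flipFace hM).face ≠ x.face :=
  ((hM.exactlyTwo_faces x.edge_mem).exists_ne x.face).choose_spec.2

theorem face_flipFace_eq (x : Flag M) {F : Set S} (hF : M.IsFace F) (heF : x.edge ⊆ F)
    (hne : F ≠ x.face) : (x.flipFace hM).face = F :=
  (hM.exactlyTwo_faces x.edge_mem).eq_of_ne
    ⟨(x.flipFace hM).isFace, (x.flipFace hM).edge_subset_face⟩ ⟨hF, heF⟩
    ⟨x.isFace, x.edge_subset_face⟩ (x.face_flipFace_ne hM) hne

theorem flipFace_flipFace (x : Flag M) : (x.flipFace hM).flipFace hM = x :=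
  Flag.ext rfl rfl ((x.flipFace hM).face_flipFace_eq hM x.isFace x.edge_subset_face
    (x.face_flipFace_ne hM).symm)

theorem flipVertex_flipFace (x : Flag M) :
    (x.flipFace hM).flipVertex = x.flipVertex.flipFace hM := by
  refine Flag.ext ?_ rfl ?_
  · exact (x.flipFace hM).vertex_flipVertex_eq x.flipVertex.vertex_mem
      x.flipVertex.vertex_mem_edge x.vertex_flipVertex_ne
  · exact (x.flipVertex.face_flipFace_eq hM (x.flipFace hM).isFace
      (x.flipFace hM).edge_subset_face (x.face_flipFace_ne hM)).symm

/-! ### Rotation about a vertex and labels of flags. -/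

/-- The next flag around the vertex. -/
noncomputable def rotate (x : Flag M) : Flag M := (x.flipFace hM).flipEdge

theorem vertex_iterate_rotate (x : Flag M) (k : ℕ) : ((rotate hM)^[k] x).vertex = x.vertex := by
  induction k with
  | zero => rfl
  | succ k ih => rw [Function.iterate_succ_apply', ← ih]; rfl

/-- `rotate` is a product of two involutions, so conjugation by either of them inverts it. This form
avoids inverse powers. -/
theorem iterate_rotate_flipEdge_iterate (x : Flag M) (k : ℕ) :
    (rotate hM)^[k] (flipEdge ((rotate hM)^[k] x)) = x.flipEdge := by
  induction k generalizing x with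
  | zero => rfl
  | succ k ih =>
    rw [Function.iterate_succ_apply, Function.iterate_succ_apply']
    rw [show rotate hM (flipEdge (rotate hM ((rotate hM)^[k] x))) =
      flipEdge ((rotate hM)^[k] x) by simp [rotate, flipEdge_flipEdge, flipFace_flipFace], ih]

theorem iterate_rotate_flipFace_iterate (x : Flag M) (k : ℕ) :
    (rotate hM)^[k] (flipFace hM ((rotate hM)^[k] x)) = x.flipFace hM := by
  induction k generalizing x with
  | zero => rfl
  | succ k ih =>
    rw [Function.iterate_succ_apply, Function.iterate_succ_apply']
    rw [show rotate hM (flipFace hM (rotate hM ((rotate hM)^[k] x))) =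
      flipFace hM ((rotate hM)^[k] x) by simp [rotate, flipEdge_flipEdge, flipFace_flipFace], ih]

/-- The sizes of the faces around the vertex of a flag, starting at its face and crossing its edge
first. -/
noncomputable def label (x : Flag M) : List ℕ :=
  (List.range (M.degree x.vertex)).map fun k => M.faceSize ((rotate hM)^[k] x).face

section Rotation

variable {v : S} {f : List ℕ} {F e : ℕ → Set S}

theorem exists_isRotation (hM : M.IsLocallyCyclic) (x : Flag M) :
    ∃ f F e, 3 ≤ f.length ∧ M.IsRotation x.vertex f F e := by
  obtain ⟨f, hf, hvf⟩ := hM x.vertex x.vertex_mem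
  obtain ⟨F, e, h⟩ := hvf.exists_isRotation (List.length_pos_iff.1 (by omega))
  exact ⟨f, F, e, hf, h⟩

theorem edge_face_iterate_rotate {x : Flag M} (h : M.IsRotation x.vertex f F e)
    (hf : 2 ≤ f.length) {i : ℕ} (he : x.edge = e i) (hF : x.face = F i) (k : ℕ) :
    ((rotate hM)^[k] x).edge = e (i + k) ∧ ((rotate hM)^[k] x).face = F (i + k) := by
  induction k with
  | zero => exact ⟨he, hF⟩
  | succ k ih =>
    have hv := x.vertex_iterate_rotate hM k
    rw [Function.iterate_succ_apply', ← add_assoc]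
    set y := (rotate hM)^[k] x
    have h1 : (y.flipFace hM).face = F (i + k + 1) := by
      refine y.face_flipFace_eq hM (h.isFace_iff.2 ⟨_, rfl⟩).1 ?_ ?_
      · rw [ih.1]
        exact h.edge_subset_succ _
      · rw [ih.2]
        exact fun h' => IsRotation.not_modEq_succ hf _ (h.face_eq_iff.1 h')
    have hedge := h.isEdge_iff.2 ⟨i + k + 1, rfl⟩
    refine ⟨(y.flipFace hM).edge_flipEdge_eq hedge.1 ?_ ?_ ?_, h1⟩
    · rw [vertex_flipFace, hv]
      exact hedge.2
    · rw [h1]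
      exact h.edge_subset _
    · rw [edge_flipFace, ih.1]
      exact fun h' => IsRotation.not_modEq_succ hf _ (h.edge_eq_iff.1 h')

theorem exists_edge_eq_or_flipEdge {x : Flag M} (h : M.IsRotation x.vertex f F e) :
    ∃ i, x.face = F i ∧ (x.edge = e i ∨ x.flipEdge.edge = e i) := by
  obtain ⟨i, hi⟩ := h.isFace_iff.1 ⟨x.isFace, x.vertex_mem_face⟩
  refine ⟨i, hi, or_iff_not_imp_left.2 fun hne => ?_⟩
  have hedge := h.isEdge_iff.2 ⟨i, rfl⟩
  exact x.edge_flipEdge_eq hedge.1 hedge.2 (hi ▸ h.edge_subset i) (Ne.symm hne)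

theorem iterate_degree_rotate (x : Flag M) : (rotate hM)^[M.degree x.vertex] x = x := by
  obtain ⟨f, F, e, hf, h⟩ := exists_isRotation hM x
  have key : ∀ y : Flag M, y.vertex = x.vertex → ∀ i, y.edge = e i → y.face = F i →
      (rotate hM)^[M.degree x.vertex] y = y := fun y hy i he hF => by
    rw [h.degree_eq (by omega)]
    rw [← hy] at h
    obtain ⟨h1, h2⟩ := edge_face_iterate_rotate hM h (by omega) he hF f.length
    refine Flag.ext (vertex_iterate_rotate hM _ _) (h1.trans ?_) (h2.trans ?_)
    · rw [he, h.edge_eq_iff]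
      exact Nat.add_modEq_right
    · rw [hF, h.face_eq_iff]
      exact Nat.add_modEq_right
  -- A flag oriented against the rotation is handled through its edge flip, which is oriented along
  -- it.
  obtain ⟨i, hF, he | he⟩ := exists_edge_eq_or_flipEdge h
  · exact key x rfl i he hF
  · have h1 := iterate_rotate_flipEdge_iterate hM x.flipEdge (M.degree x.vertex)
    rwa [key x.flipEdge rfl i he hF, flipEdge_flipEdge] at h1

theorem label_eq_rotate {x : Flag M} (h : M.IsRotation x.vertex f F e) (hf : 2 ≤ f.length) {i : ℕ}
    (he : x.edge = e i) (hF : x.face = F i) : x.label hM = f.rotate i := by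
  refine List.ext_getElem (by simp [label, h.degree_eq (by omega : 0 < f.length)])
    fun k h₁ h₂ => ?_
  rw [List.getElem_rotate]
  simp only [label, List.getElem_map, List.getElem_range]
  rw [(edge_face_iterate_rotate hM h hf he hF k).2]
  have := faceSize_eq (h.isGon (i + k) (Nat.mod_lt _ (by omega)))
  rw [this]
  simp only [add_comm]

end Rotation

theorem two_le_degree (hM : M.IsLocallyCyclic) (x : Flag M) : 2 ≤ M.degree x.vertex := by
  obtain ⟨f, F, e, hf, h⟩ := exists_isRotation hM x
  rw [h.degree_eq (by omega)]
  omega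

theorem label_flipEdge (x : Flag M) : x.flipEdge.label hM = turnBack (x.label hM) := by
  have hx := x.iterate_degree_rotate hM
  rw [label, label, turnBack_map_range (two_le_degree hM x) (by rw [hx]; rfl)]
  refine List.map_congr_left fun k hk => ?_
  have hk' : k ≤ M.degree x.vertex := (List.mem_range.1 hk).le
  -- Since `rotate` has period the degree `n`, its `(n - k)`-th power serves as the inverse of the
  -- `k`-th.
  have h1 := iterate_rotate_flipEdge_iterate hM ((rotate hM)^[M.degree x.vertex - k] x) k
  rw [← Function.iterate_add_apply, Nat.add_sub_cancel' hk', hx] at h1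
  rw [h1, face_flipEdge]

theorem label_flipFace (x : Flag M) : (x.flipFace hM).label hM = crossEdge (x.label hM) := by
  have hx := x.iterate_degree_rotate hM
  rw [label, label, crossEdge_map_range (two_le_degree hM x) (by rw [hx]; rfl)
    (by rw [Function.iterate_succ_apply', hx]; rfl)]
  refine List.map_congr_left fun k hk => ?_
  have hk' : k ≤ M.degree x.vertex := (List.mem_range.1 hk).le
  have h1 := iterate_rotate_flipFace_iterate hM ((rotate hM)^[M.degree x.vertex - k] x) k
  rw [← Function.iterate_add_apply, Nat.add_sub_cancel' hk', hx] at h1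
  rw [h1, Function.iterate_succ_apply']
  rfl

theorem take_label (x : Flag M) :
    (x.label hM).take 2 = [M.faceSize x.face, M.faceSize (x.flipFace hM).face] := by
  obtain ⟨m, hm⟩ := Nat.exists_eq_add_of_le' (two_le_degree hM x)
  rw [label, hm, List.range_succ_eq_map, List.range_succ_eq_map]
  rfl

theorem sameFaceSeq_label {x : Flag M} {f : List ℕ} (h : M.HasFaceSeq x.vertex f)
    (hf : 2 ≤ f.length) : SameFaceSeq (x.label hM) f := by
  obtain ⟨F, e, h⟩ := h.exists_isRotation (List.length_pos_iff.1 (by omega))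
  obtain ⟨i, hF, he | he⟩ := exists_edge_eq_or_flipEdge h
  · rw [label_eq_rotate hM h hf he hF]
    exact Or.inl (List.IsRotated.symm ⟨i, rfl⟩)
  · rw [← x.flipEdge_flipEdge, label_flipEdge]
    refine (sameFaceSeq_turnBack _).trans ?_
    rw [label_eq_rotate (x := x.flipEdge) hM h hf he hF]
    exact Or.inl (List.IsRotated.symm ⟨i, rfl⟩)

end Flag

/-- The flags of a map form a flag system. -/
noncomputable def flagSystem (hM : M.IsLocallyCyclic) : FlagSystem (Flag M) where
  s0 := Flag.flipVertex
  s1 := Flag.flipEdge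
  s2 := Flag.flipFace hM
  lab := Flag.label hM
  s0_s0 := Flag.flipVertex_flipVertex
  s0_s2 := Flag.flipVertex_flipFace hM
  lab_s1 := Flag.label_flipEdge hM
  lab_s2 := Flag.label_flipFace hM
  take_lab_s0 x := by
    rw [Flag.take_label, Flag.take_label, ← Flag.flipVertex_flipFace]
    rfl
  iterate_face x p hp := by
    have hp' : ((Flag.label hM x).take 2).head? = some p := by
      rw [← hp]
      cases Flag.label hM x <;> rfl
    rw [Flag.take_label, List.head?_cons, Option.some_inj] at hp'
    rw [← hp']
    exact x.iterate_flipEdge_flipVertex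

end SurfaceMap

/-! ### Connectedness: propagating a vertex property along edges. -/

namespace SurfaceMap

variable {S : Type*} [TopologicalSpace S] {M : SurfaceMap S}

theorem IsLocallyCyclic.exists_face_of_vertex (hM : M.IsLocallyCyclic) {v : S} (hv : v ∈ M.V) :
    ∃ F, M.IsFace F ∧ v ∈ F := by
  obtain ⟨f, hf, hvf⟩ := hM v hv
  obtain ⟨F, e, h⟩ := hvf.exists_isRotation (List.length_pos_iff.1 (by omega))
  exact ⟨F 0, h.isFace_iff.2 ⟨0, rfl⟩⟩

theorem IsLocallyCyclic.exists_face (hM : M.IsLocallyCyclic) (y : S) : ∃ F, M.IsFace F ∧ y ∈ F := by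
  by_cases hy : y ∈ M.carrier
  · rcases hy with hy | ⟨e, he, hye⟩
    · exact hM.exists_face_of_vertex hy
    · obtain ⟨F, F', -, hF⟩ := hM.exactlyTwo_faces he
      obtain ⟨hface, heF⟩ := (hF F).2 (Or.inl rfl)
      exact ⟨F, hface, heF hye⟩
  · exact ⟨_, ⟨_, ⟨y, hy, rfl⟩, rfl⟩, subset_closure (mem_connectedComponentIn hy)⟩

theorem exists_vertex_mem_face {F : Set S} (hF : M.IsFace F) : ∃ v ∈ M.V, v ∈ F := by
  obtain ⟨c, a, h⟩ := exists_isPolygon hF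
  exact ⟨c 0, (h.corner_mem_side 0).2, h.side_subset 0 (h.corner_mem_side 0).1⟩

theorem IsLocallyCyclic.finite_faces (hM : M.IsLocallyCyclic) : {F | M.IsFace F}.Finite := by
  have hsub : {F | M.IsFace F} ⊆ ⋃ v ∈ M.V, {F | M.IsFace F ∧ v ∈ F} := fun F hF => by
    obtain ⟨v, hv, hvF⟩ := exists_vertex_mem_face hF
    exact mem_biUnion hv ⟨hF, hvF⟩
  refine (M.finite_V.biUnion fun v hv => ?_).subset hsub
  obtain ⟨f, -, -, F, e, -, -, hF, -⟩ := hM v hv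
  rw [← hF]
  exact finite_range F

theorem isClosed_biUnion_faces (hM : M.IsLocallyCyclic) (P : Set S → Prop) :
    IsClosed (⋃ F ∈ {F | M.IsFace F ∧ P F}, F) := by
  refine (hM.finite_faces.subset fun F hF => hF.1).isClosed_biUnion fun F hF => ?_
  obtain ⟨C, -, rfl⟩ := hF.1
  exact isClosed_closure

theorem exists_vertex_mem_inter {F F' : Set S} (hF : M.IsFace F) (hF' : M.IsFace F')
    (h : (F ∩ F').Nonempty) : ∃ v ∈ M.V, v ∈ F ∧ v ∈ F' := by
  by_cases hne : F = F'
  · subst hne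
    obtain ⟨v, hv, hvF⟩ := exists_vertex_mem_face hF
    exact ⟨v, hv, hvF, hvF⟩
  rcases M.inter_faces F F' hF hF' hne h with ⟨v, hv, heq⟩ | he
  · exact ⟨v, hv, by simp [← mem_inter_iff, heq]⟩
  · obtain ⟨v, w, -, h⟩ := exactlyTwo_vertices he
    obtain ⟨hv, hvF⟩ := (h v).2 (Or.inl rfl)
    exact ⟨v, hv, hvF⟩

/-- If a property of vertices is invariant along edges, then it is invariant along faces. -/
theorem forall_vertex_mem_face {P : S → Prop}
    (hP : ∀ x : Flag M, P x.vertex → P x.flipVertex.vertex) {F : Set S} (hF : M.IsFace F) {v w : S}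
    (hv : v ∈ M.V) (hvF : v ∈ F) (hw : w ∈ M.V) (hwF : w ∈ F) (hPv : P v) : P w := by
  obtain ⟨c, a, h⟩ := exists_isPolygon hF
  have hadd : ∀ k, P (c k) → P (c (k + 1)) := fun k hk => by
    have h0 := h.corner_mem_side k
    have h1 := h.corner_succ_mem_side k
    let x : Flag M := ⟨c k, a k, F, h0.2, h.side_mem k, hF, h0.1, h.side_subset k⟩
    rw [← x.vertex_flipVertex_eq h1.2 h1.1 (h.corner_ne_corner_succ k)]
    exact hP x hk
  have hsub : ∀ k, P (c (k + 1)) → P (c k) := fun k hk => by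
    have h0 := h.corner_mem_side k
    have h1 := h.corner_succ_mem_side k
    let x : Flag M := ⟨c (k + 1), a k, F, h1.2, h.side_mem k, hF, h1.1, h.side_subset k⟩
    rw [← x.vertex_flipVertex_eq h0.2 h0.1 (h.corner_ne_corner_succ k).symm]
    exact hP x hk
  obtain ⟨j, rfl⟩ := h.exists_corner v hv hvF
  obtain ⟨k, rfl⟩ := h.exists_corner w hw hwF
  exact Int.inductionOn' (motive := fun k => P (c k)) k j hPv (fun k _ hk => hadd k hk)
    fun k _ hk => hsub (k - 1) (by rwa [sub_add_cancel])

/-- On a connected space, a property of vertices that is invariant along edges and holds for some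
vertex holds for all. -/
theorem forall_vertex_of_flipVertex [PreconnectedSpace S] (hM : M.IsLocallyCyclic) {P : S → Prop}
    (hP : ∀ x : Flag M, P x.vertex → P x.flipVertex.vertex) {v w : S} (hv : v ∈ M.V)
    (hw : w ∈ M.V) (hPv : P v) : P w := by
  set A : Set S := ⋃ F ∈ {F | M.IsFace F ∧ ∃ u ∈ M.V, u ∈ F ∧ P u}, F
  set B : Set S := ⋃ F ∈ {F | M.IsFace F ∧ ∃ u ∈ M.V, u ∈ F ∧ ¬P u}, F with hB
  -- The faces cover `S`, so `A ∪ B` is everything. Faces from both families that met would share a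
  -- vertex, and invariance along face boundaries would make `P` both true and false there.
  have hAB : Aᶜ = B := by
    ext y
    constructor
    · intro hy
      obtain ⟨F, hF, hyF⟩ := hM.exists_face y
      obtain ⟨u, hu, huF⟩ := exists_vertex_mem_face hF
      exact mem_biUnion (x := F) ⟨hF, u, hu, huF, fun hPu =>
        hy (mem_biUnion (x := F) ⟨hF, u, hu, huF, hPu⟩ hyF)⟩ hyF
    · intro hy hyA
      obtain ⟨F, ⟨hF, u, hu, huF, hPu⟩, hyF⟩ := mem_iUnion₂.1 hyA
      obtain ⟨F', ⟨hF', u', hu', huF', hPu'⟩, hyF'⟩ := mem_iUnion₂.1 hy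
      obtain ⟨z, hz, hzF, hzF'⟩ := exists_vertex_mem_inter hF hF' ⟨y, hyF, hyF'⟩
      exact hPu' (forall_vertex_mem_face hP hF' hz hzF' hu' huF'
        (forall_vertex_mem_face hP hF hu huF hz hzF hPu))
  have hclopen : IsClopen A := by
    refine ⟨isClosed_biUnion_faces hM _, ?_⟩
    rw [← isClosed_compl_iff, hAB]
    exact isClosed_biUnion_faces hM _
  obtain ⟨F, hF, hvF⟩ := hM.exists_face_of_vertex hv
  have hvA : v ∈ A := mem_biUnion (x := F) ⟨hF, v, hv, hvF, hPv⟩ hvF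
  have huniv : A = univ := (isClopen_iff.1 hclopen).resolve_left (Set.Nonempty.ne_empty ⟨v, hvA⟩)
  obtain ⟨F', hF', hwF'⟩ := hM.exists_face_of_vertex hw
  by_contra hPw
  have hwB : w ∈ B := mem_biUnion (x := F') ⟨hF', w, hw, hwF', hPw⟩ hwF'
  rw [← hAB, huniv] at hwB
  exact hwB trivial

theorem exists_flag (hM : M.IsLocallyCyclic) {v : S} (hv : v ∈ M.V) :
    ∃ x : Flag M, x.vertex = v := by
  obtain ⟨F, hF, hvF⟩ := hM.exists_face_of_vertex hv
  obtain ⟨e, e', -, he⟩ := exactlyTwo_edges hF hv hvF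
  obtain ⟨heE, hve, heF⟩ := (he e).2 (Or.inl rfl)
  exact ⟨⟨v, e, F, hv, heE, hF, hve, heF⟩, rfl⟩

theorem HasFaceSeq.three_le {v : S} {f : List ℕ} (h : M.HasFaceSeq v f) : ∀ p ∈ f, 3 ≤ p := by
  obtain ⟨-, F, e, -, -, -, -, h⟩ := h
  intro p hp
  obtain ⟨i, rfl⟩ := List.get_of_mem hp
  exact (h i).1.1

end SurfaceMap

/-! ### The surfaces and the conclusion. -/

theorem preconnectedSpace_of_homeomorph {S : Type*} [TopologicalSpace S]
    (hS : Nonempty (S ≃ₜ Torus) ∨ Nonempty (S ≃ₜ KleinBottle)) : PreconnectedSpace S := by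
  rcases hS with ⟨⟨h⟩⟩ | ⟨⟨h⟩⟩
  · exact (h.symm.surjective.connectedSpace h.symm.continuous).toPreconnectedSpace
  · have : ConnectedSpace KleinBottle :=
      Quot.mk_surjective.connectedSpace continuous_quot_mk
    exact (h.symm.surjective.connectedSpace h.symm.continuous).toPreconnectedSpace

theorem theorem1 {S : Type*} [TopologicalSpace S]
    (hS : Nonempty (S ≃ₜ Torus) ∨ Nonempty (S ≃ₜ KleinBottle))
    (M : SurfaceMap S) (f₁ f₂ : List ℕ)
    (hM : M.IsTwoSemiEquivelar f₁ f₂) (hcurv : M.HasCurvature 0) :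
    ∃ t ∈ sixteenTypes,
      (SameFaceSeq f₁ t.1 ∧ SameFaceSeq f₂ t.2) ∨ (SameFaceSeq f₁ t.2 ∧ SameFaceSeq f₂ t.1) := by
  have := preconnectedSpace_of_homeomorph hS
  obtain ⟨hne, ⟨v₁, hv₁⟩, ⟨v₂, hv₂⟩, hall⟩ := hM
  have len : ∀ {v f}, M.HasFaceSeq v f → 3 ≤ f.length := fun h =>
    three_le_flat_length h.three_le (hcurv _ _ h)
  have hcyc : M.IsLocallyCyclic := fun v hv =>
    (hall v hv).elim (fun h => ⟨f₁, len h, h⟩) fun h => ⟨f₂, len h, h⟩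
  obtain ⟨t₁, ht₁, hft₁⟩ := exists_flatType hv₁.three_le (hcurv _ _ hv₁)
  obtain ⟨t₂, ht₂, hft₂⟩ := exists_flatType hv₂.three_le (hcurv _ _ hv₂)
  have hlab : ∀ {x : SurfaceMap.Flag M} {f}, M.HasFaceSeq x.vertex f →
      SameFaceSeq (x.label hcyc) f := fun h =>
    SurfaceMap.Flag.sameFaceSeq_label hcyc h ((by norm_num : 2 ≤ 3).trans (len h))
  obtain ⟨x, hx₁, hx₂⟩ : ∃ x : SurfaceMap.Flag M,
      M.HasFaceSeq x.vertex f₁ ∧ M.HasFaceSeq x.flipVertex.vertex f₂ := by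
    -- Without a mixed edge, `f₁` would spread to `v₂`; one label at `v₂` would then represent both
    -- `f₁` and `f₂`.
    by_contra! hno
    have h₂ : M.HasFaceSeq v₂ f₁ := SurfaceMap.forall_vertex_of_flipVertex hcyc
      (P := fun v => M.HasFaceSeq v f₁)
      (fun x hx => (hall _ x.flipVertex.vertex_mem).resolve_right (hno x hx)) hv₁.1 hv₂.1 hv₁
    obtain ⟨x, rfl⟩ := SurfaceMap.exists_flag hcyc hv₂.1
    exact hne ((hlab h₂).symm.trans (hlab hv₂))
  have hX : ∀ y, (SurfaceMap.flagSystem hcyc).lab y ∈ readings t₁ ++ readings t₂ := fun y => by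
    rw [List.mem_append, mem_readings, mem_readings]
    exact (hall _ y.vertex_mem).imp (fun h => (hlab h).trans hft₁) fun h => (hlab h).trans hft₂
  have hmix := (SurfaceMap.flagSystem hcyc).mixes_eq_true
    ((SurfaceMap.flagSystem hcyc).state_mem_edgeStates hX) (x := x)
    ((hlab hx₁).trans hft₁) ((hlab hx₂).trans hft₂) 10
  rcases mem_sixteenTypes_of_mixes t₁ ht₁ t₂ ht₂ with rfl | h | h | h
  · exact absurd (hft₁.trans hft₂.symm) hne
  · exact ⟨_, h, Or.inl ⟨hft₁, hft₂⟩⟩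
  · exact ⟨_, h, Or.inr ⟨hft₁, hft₂⟩⟩
  · rw [hmix] at h
    exact absurd h (by decide)
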